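/- Conventions. Graphs are finite and may have loops and parallel edges; an edge consists of two distinct half-edges, each incident on one vertex. Let $F$ be a 4-regular graph (every vertex is incident on exactly four half-edges). A circuit is a nonempty closed trail: a cyclic sequence of passages $(h_i,v_i,h_i')$, arriving at $v_i$ on the half-edge $h_i$ and leaving it on $h_i'$, in which $h_i'$ and $h_{i+1}$ belong to the same edge and all half-edges are pairwise distinct. Two circuits are the same if they differ only in starting point or orientation. A circuit partition $P$ of $F$ is a partition of the edge set of $F$ into edge-disjoint circuits; the pairs $\{h_i,h_i'\}$ occurring at passages of circuits of $P$ are the single transitions of $P$, and there are two of them at each vertex. An Euler system of $F$ is a set containing precisely one Euler circuit for each connected component of $F$. If $C$ is an Euler system and $v$ is a vertex, the two fundamental circuits of $C$ at $v$ are the circuits obtained by following a circuit of $C$ from $v$ to $v$. The touch-graph $Tch(P)$ has a vertex for each circuit of $P$ and an edge $e_v$ for each vertex $v$ of $F$; the half-edges of $e_v$ are the two single transitions of $P$ at $v$, each incident on the circuit of $P$ that contains it. For a half-edge $h$ of $F$, let $\overline h$ be the single transition of $P$ that contains $h$. The shadow $\overline W$ in $Tch(P)$ of an oriented circuit $W$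 of $F$ is the closed walk in which a passage $h,v,h'$ of $W$ contributes a traversal of $e_v$ from $\overline h$ to $\overline{h'}$ if $\{h,h'\}$ is not a single transition of $P$, and contributes nothing otherwise. A directed version $D$ of $Tch(P)$ designates one half-edge of each edge as initial, and $z_D(\overline W)\in\mathbb Z^{V(F)}$ tallies, in the $v$ coordinate, $+1$ for each traversal of $e_v$ in the $D$ direction and $-1$ for each traversal of $e_v$ against it. If $\Gamma=\{C_\Gamma(v)\mid v\in V(F)\}$ consists of one oriented fundamental circuit $C_\Gamma(v)$ of $C$ at each vertex $v$ (with arbitrary orientations), then $M_{\mathbb R,\Gamma}(C,P,D)$ is the $V(F)\times V(F)$ integer matrix whose $v$ row is $z_D(\overline{C_\Gamma(v)})$. Theorem. Let $E$ be a set of base edges of $F$, i.e. a set containing exactly one edge from each connected component of $F$. Let $C$ and $\widetilde C$ be Euler systems of $F$, and let $\Gamma_E$ and $\widetilde\Gamma_E$ be sets of oriented fundamental circuits of $C$ and $\widetilde C$ (respectively), one at each vertex, that are based at $E$, i.e. all of whose circuits exclude every element of $E$. Then the following two properties hold. I. For every circuit partition $P$ of $F$ and every directed version $D$ of $Tch(P)$,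 the matrices $M_{\mathbb R,\Gamma_E}(C,P,D)$ and $M_{\mathbb R,\widetilde\Gamma_E}(\widetilde C,P,D)$ are row equivalent over $\mathbb Z$; that is, one can be obtained from the other by a finite sequence of the operations ``multiply a row by $-1$'' and ``add an integer multiple of one row to a different row''. II. There is a single finite sequence of these row operations that transforms $M_{\mathbb R,\Gamma_E}(C,P,D)$ into $M_{\mathbb R,\widetilde\Gamma_E}(\widetilde C,P,D)$ for every choice of $P$ and $D$. -/

import Mathlib

/-- A graph, possibly with loops and parallel edges, with vertices `V`, edges `E` and half-edges `H`:
every half-edge is incident on one vertex, and every edge consists of two distinct half-edges. -/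
structure HalfEdgeGraph (V E H : Type*) where
  /-- the vertex on which a half-edge is incident -/
  vert : H → V
  /-- the edge to which a half-edge belongs -/
  edge : H → E
  two_halves : ∀ e : E, {h : H | edge h = e}.ncard = 2

namespace HalfEdgeGraph

variable {V E H : Type*}

/-- A graph is 4-regular if every vertex is incident on exactly four half-edges. -/
def IsFourRegular (F : HalfEdgeGraph V E H) : Prop :=
  ∀ v : V, {h : H | F.vert h = v}.ncard = 4

/-- Two vertices are neighbors if some edge has them as its two ends. -/
def adjacency (F : HalfEdgeGraph V E H) : SimpleGraph V :=
  SimpleGraph.fromRel fun u v => ∃ h h' : H, F.edge h = F.edge h' ∧ F.vert h = u ∧ F.vert h' = v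

/-- The connected components of a graph. -/
abbrev Component (F : HalfEdgeGraph V E H) : Type _ := F.adjacency.ConnectedComponent

/-- The edge `e` lies in the component `K`. -/
def EdgeInComponent (F : HalfEdgeGraph V E H) (e : E) (K : F.Component) : Prop :=
  ∀ h : H, F.edge h = e → F.adjacency.connectedComponentMk (F.vert h) = K

/-- `B` is a set of base edges: it contains exactly one edge from each component. -/
def IsBaseEdgeSet (F : HalfEdgeGraph V E H) (B : Set E) : Prop :=
  ∀ K : F.Component, ∃! e : E, e ∈ B ∧ F.EdgeInComponent e K

/-- A directed version of a graph: each edge has one of its half-edges distinguished as initial. -/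
structure Orientation (G : HalfEdgeGraph V E H) where
  init : E → H
  edge_init : ∀ e : E, G.edge (init e) = e

/-! ### Circuits -/

/-- An oriented circuit, i.e. an oriented closed trail up to the choice of its starting point.
It is recorded by its cyclic sequence of passages `(hᵢ, hᵢ')` through vertices `vᵢ`: the circuit
arrives at `vᵢ` on the half-edge `hᵢ` and leaves `vᵢ` on `hᵢ'`; the half-edges `hᵢ'` and `hᵢ₊₁`
belong to the same edge, and all the half-edges are pairwise distinct. -/
@[ext]
structure OrientedCircuit (F : HalfEdgeGraph V E H) where
  passages : Cycle (H × H)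
  ne_nil : passages ≠ Cycle.nil
  incident : ∀ p ∈ passages, F.vert p.1 = F.vert p.2
  chain : passages.Chain fun p q => F.edge p.2 = F.edge q.1
  nodup : (passages.toMultiset.map Prod.fst + passages.toMultiset.map Prod.snd).Nodup

variable {F : HalfEdgeGraph V E H}

namespace OrientedCircuit

/-- The edge `e` is traversed by the oriented circuit `c`. -/
def IncludesEdge (c : OrientedCircuit F) (e : E) : Prop :=
  ∃ p ∈ c.passages, F.edge p.2 = e

/-- Two oriented circuits are the same circuit if they are equal or reverses of each other
(starting points are already forgotten). -/
def setoid (F : HalfEdgeGraph V E H) : Setoid (OrientedCircuit F) where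
  r c c' := c'.passages = c.passages ∨ c'.passages = (c.passages.map Prod.swap).reverse
  iseqv := by
    have key : ∀ s : Cycle (H × H), ((s.map Prod.swap).reverse.map Prod.swap).reverse = s := by
      intro s
      induction s using Quotient.inductionOn'
      rename_i l
      change ((((l : Cycle (H × H)).map Prod.swap).reverse.map Prod.swap).reverse) = l
      simp
    refine ⟨fun c => Or.inl rfl, ?_, ?_⟩
    · rintro c c' (h | h)
      · exact Or.inl h.symm
      · exact Or.inr (by rw [h, key])
    · rintro c c' c'' (h | h) (h' | h')
      · exact Or.inl (h'.trans h)
      · exact Or.inr (by rw [h', h])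
      · exact Or.inr (by rw [h', h])
      · exact Or.inl (by rw [h', h, key])

end OrientedCircuit

/-- A circuit: an oriented circuit with its orientation forgotten. -/
def Circuit (F : HalfEdgeGraph V E H) : Type _ := Quotient (OrientedCircuit.setoid F)

/-- The circuit underlying an oriented circuit. -/
def OrientedCircuit.toCircuit (c : OrientedCircuit F) : Circuit F :=
  Quotient.mk (OrientedCircuit.setoid F) c

namespace Circuit

/-- The circuit `γ` includes the edge `e`. -/
def IncludesEdge (γ : Circuit F) (e : E) : Prop :=
  ∃ c : OrientedCircuit F, c.toCircuit = γ ∧ c.IncludesEdge e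

/-- The single transitions of `γ`: the pairs of half-edges consecutive on `γ` at some vertex. -/
def singleTransitions (γ : Circuit F) : Set (Sym2 H) :=
  {t | ∃ c : OrientedCircuit F, c.toCircuit = γ ∧ ∃ p ∈ c.passages, s(p.1, p.2) = t}

/-- `γ` is an Euler circuit of the component `K`. -/
def IsEulerCircuit (γ : Circuit F) (K : F.Component) : Prop :=
  ∀ e : E, γ.IncludesEdge e ↔ F.EdgeInComponent e K

end Circuit

/-- An Euler system: a set containing precisely one Euler circuit for each component of `F`. -/
structure EulerSystem (F : HalfEdgeGraph V E H) where
  circuits : Set (Circuit F)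
  isEuler : ∀ γ ∈ circuits, ∃ K : F.Component, γ.IsEulerCircuit K
  existsUnique : ∀ K : F.Component, ∃! γ, γ ∈ circuits ∧ γ.IsEulerCircuit K

/-- A circuit partition: a partition of the edge set of `F` into edge-disjoint circuits. -/
structure CircuitPartition (F : HalfEdgeGraph V E H) where
  circuits : Set (Circuit F)
  existsUnique : ∀ e : E, ∃! γ, γ ∈ circuits ∧ γ.IncludesEdge e

/-! ### Fundamental circuits -/

/-- The oriented circuit `f` is obtained by following the oriented circuit `c` from `v` to `v`:
if `c` is `…, h₁, v, h₂, …, h₃, v, h₄, …`, then `f` leaves `v` on `h₂`, follows `c` until it arrives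
at `v` on `h₃`, and closes up there. (Rotating `c` gives the other one, from `h₄` to `h₁`.) -/
def OrientedCircuit.FollowsFrom (f c : OrientedCircuit F) (v : V) : Prop :=
  ∃ (h₁ h₂ h₃ h₄ : H) (A B : List (H × H)),
    F.vert h₂ = v ∧ F.vert h₃ = v ∧
    c.passages = (((h₁, h₂) :: (A ++ (h₃, h₄) :: B) : List (H × H)) : Cycle (H × H)) ∧
    f.passages = (((h₃, h₂) :: A : List (H × H)) : Cycle (H × H))

/-- A set `Γ` including one oriented fundamental circuit `C_Γ(v)` of the Euler system `C` at each
vertex `v`. Either orientation of each fundamental circuit is allowed. -/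
structure FundamentalCircuits (C : EulerSystem F) where
  circuit : V → OrientedCircuit F
  isFundamental : ∀ v : V, ∃ c : OrientedCircuit F,
    c.toCircuit ∈ C.circuits ∧ (circuit v).FollowsFrom c v

/-- `Γ` is based at `B`: its circuits exclude every element of `B`. -/
def FundamentalCircuits.IsBasedAt {C : EulerSystem F} (Γ : FundamentalCircuits C) (B : Set E) :
    Prop :=
  ∀ v : V, ∀ e ∈ B, ¬ (Γ.circuit v).IncludesEdge e

/-! ### Touch-graphs -/

namespace CircuitPartition

/-- The single transitions of the circuits of `P`. They serve as the half-edges of `Tch(P)`. -/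
def SingleTransition (P : CircuitPartition F) : Type _ :=
  {t : Sym2 H // ∃ γ ∈ P.circuits, t ∈ γ.singleTransitions}

end CircuitPartition

theorem eq_or_eq_of_edge_eq {a b h : H} (hab : a ≠ b) (e₁ : F.edge a = F.edge b)
    (e₂ : F.edge h = F.edge b) : h = a ∨ h = b := by
  obtain ⟨x, y, -, hxy⟩ := Set.ncard_eq_two.1 (F.two_halves (F.edge b))
  have ha : a ∈ ({x, y} : Set H) := hxy ▸ e₁
  have hb : b ∈ ({x, y} : Set H) := hxy ▸ (rfl : F.edge b = F.edge b)
  have hh : h ∈ ({x, y} : Set H) := hxy ▸ e₂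
  simp only [Set.mem_insert_iff, Set.mem_singleton_iff] at ha hb hh
  grind

namespace OrientedCircuit

theorem toMultiset_mem {c : Cycle (H × H)} {p : H × H} : p ∈ c.toMultiset ↔ p ∈ c := by
  induction c using Quotient.inductionOn'
  exact Iff.rfl

theorem exists_next (c : OrientedCircuit F) {p : H × H} (hp : p ∈ c.passages) :
    ∃ q ∈ c.passages, F.edge p.2 = F.edge q.1 := by
  have hc := c.chain
  generalize c.passages = s at hp hc
  induction s using Quotient.inductionOn'
  rename_i l
  change p ∈ l at hp
  obtain ⟨l₁, l₂, rfl⟩ := List.append_of_mem hp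
  have hrot : (Quotient.mk'' (l₁ ++ p :: l₂) : Cycle (H × H)) = ((p :: (l₂ ++ l₁) : List (H × H)) : Cycle (H × H)) :=
    Cycle.coe_eq_coe.2 (by simpa using List.isRotated_append (l := l₁) (l' := p :: l₂))
  rw [hrot] at hc ⊢
  rw [Cycle.chain_coe_cons] at hc
  cases hl : l₂ ++ l₁ with
  | nil => rw [hl] at hc; exact ⟨p, by simp, by simpa using hc⟩
  | cons q m =>
    rw [hl] at hc
    simp only [List.cons_append, List.isChain_cons_cons] at hc
    exact ⟨q, by simp, hc.1⟩

theorem exists_prev (c : OrientedCircuit F) {p : H × H} (hp : p ∈ c.passages) :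
    ∃ q ∈ c.passages, F.edge q.2 = F.edge p.1 := by
  have hc := c.chain
  generalize c.passages = s at hp hc
  induction s using Quotient.inductionOn'
  rename_i l
  change p ∈ l at hp
  obtain ⟨l₁, l₂, rfl⟩ := List.append_of_mem hp
  have hrot : (Quotient.mk'' (l₁ ++ p :: l₂) : Cycle (H × H)) =
      ((p :: (l₂ ++ l₁) : List (H × H)) : Cycle (H × H)) :=
    Cycle.coe_eq_coe.2 (by simpa using List.isRotated_append (l := l₁) (l' := p :: l₂))
  rw [hrot] at hc ⊢
  rw [Cycle.chain_coe_cons] at hc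
  rcases List.eq_nil_or_concat (l₂ ++ l₁) with hl | ⟨m, q, hl⟩
  · rw [hl] at hc; exact ⟨p, by simp, by simpa using hc⟩
  · rw [hl] at hc ⊢
    refine ⟨q, by simp, ?_⟩
    have h := (List.isChain_append.1 (show List.IsChain _ ((p :: m ++ [q]) ++ [p]) by
      simpa using hc)).2.2
    exact h q List.getLast?_concat p (by simp)

theorem fst_ne_snd (c : OrientedCircuit F) {p q : H × H} (hp : p ∈ c.passages)
    (hq : q ∈ c.passages) : p.1 ≠ q.2 :=
  fun h => Multiset.disjoint_left.1 (Multiset.nodup_add.1 c.nodup).2.2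
    (Multiset.mem_map_of_mem Prod.fst (toMultiset_mem.2 hp))
    (h ▸ Multiset.mem_map_of_mem Prod.snd (toMultiset_mem.2 hq))

/-- A half-edge of an edge traversed by `c` belongs to a passage of `c`. -/
theorem exists_passage (c : OrientedCircuit F) {h : H} (hc : c.IncludesEdge (F.edge h)) :
    ∃ p ∈ c.passages, h ∈ s(p.1, p.2) := by
  obtain ⟨p, hp, he⟩ := hc
  obtain ⟨q, hq, he'⟩ := c.exists_next hp
  rcases eq_or_eq_of_edge_eq (c.fst_ne_snd hq hp) he'.symm he.symm with rfl | rfl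
  · exact ⟨q, hq, by simp⟩
  · exact ⟨p, hp, by simp⟩

/-- Two passages of `c` that share a half-edge are equal. -/
theorem passage_unique (c : OrientedCircuit F) {p q : H × H} (hp : p ∈ c.passages)
    (hq : q ∈ c.passages) {h : H} (h₁ : h ∈ s(p.1, p.2)) (h₂ : h ∈ s(q.1, q.2)) : p = q := by
  obtain ⟨n₁, n₂, -⟩ := Multiset.nodup_add.1 c.nodup
  rw [Sym2.mem_iff] at h₁ h₂
  rcases h₁ with h₁ | h₁ <;> rcases h₂ with h₂ | h₂
  · exact Multiset.inj_on_of_nodup_map n₁ p (toMultiset_mem.2 hp) q (toMultiset_mem.2 hq)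
      (h₁.symm.trans h₂)
  · exact absurd (h₁.symm.trans h₂) (c.fst_ne_snd hp hq)
  · exact absurd (h₂.symm.trans h₁) (c.fst_ne_snd hq hp)
  · exact Multiset.inj_on_of_nodup_map n₂ p (toMultiset_mem.2 hp) q (toMultiset_mem.2 hq)
      (h₁.symm.trans h₂)

/-- Passages of two orientations of the same circuit are the same up to reversal. -/
theorem exists_passage_of_toCircuit_eq {c c' : OrientedCircuit F} (hc : c.toCircuit = c'.toCircuit)
    {p : H × H} (hp : p ∈ c.passages) : ∃ q ∈ c'.passages, s(q.1, q.2) = s(p.1, p.2) := by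
  rcases (Quotient.exact hc : c'.passages = c.passages ∨
    c'.passages = (c.passages.map Prod.swap).reverse) with h | h
  · exact ⟨p, h ▸ hp, rfl⟩
  · refine ⟨p.swap, ?_, by simp [Sym2.eq_swap]⟩
    rw [h, Cycle.mem_reverse_iff, Cycle.mem_map]
    exact ⟨p, hp, rfl⟩

theorem includesEdge_of_mem (c : OrientedCircuit F) {p : H × H} (hp : p ∈ c.passages) {h : H}
    (hh : h ∈ s(p.1, p.2)) : c.toCircuit.IncludesEdge (F.edge h) := by
  rw [Sym2.mem_iff] at hh
  rcases hh with rfl | rfl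
  · obtain ⟨q, hq, he⟩ := c.exists_prev hp
    exact ⟨c, rfl, q, hq, he⟩
  · exact ⟨c, rfl, p, hp, rfl⟩

end OrientedCircuit

namespace CircuitPartition

/-- Each half-edge lies in exactly one single transition of `P`. -/
theorem existsUnique_singleTransition (P : CircuitPartition F) (h : H) :
    ∃! t : P.SingleTransition, h ∈ t.1 := by
  obtain ⟨γ, ⟨hγ, c, rfl, hc⟩, huniq⟩ := P.existsUnique (F.edge h)
  obtain ⟨p, hp, hh⟩ := c.exists_passage hc
  refine ⟨⟨s(p.1, p.2), c.toCircuit, hγ, c, rfl, p, hp, rfl⟩, hh, ?_⟩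
  rintro ⟨t, γ', hγ', c', rfl, p', hp', rfl⟩ ht
  have hcc : c'.toCircuit = c.toCircuit :=
    huniq _ ⟨hγ', c'.includesEdge_of_mem hp' ht⟩
  obtain ⟨q, hq, hqp⟩ := OrientedCircuit.exists_passage_of_toCircuit_eq hcc hp'
  have : p = q := c.passage_unique hp hq hh (hqp ▸ ht)
  subst this
  exact Subtype.ext hqp.symm

variable (P : CircuitPartition F)

/-- The single transition of `P` that includes the half-edge `h`; as a half-edge of `Tch(P)`
it is the shadow `π_P(h)` of `h`. -/
noncomputable def shadowHalfEdge (h : H) : P.SingleTransition :=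
  (P.existsUnique_singleTransition h).choose

theorem mem_shadowHalfEdge (h : H) : h ∈ (P.shadowHalfEdge h).1 :=
  (P.existsUnique_singleTransition h).choose_spec.1

theorem shadowHalfEdge_eq {h : H} {t : P.SingleTransition} (ht : h ∈ t.1) :
    P.shadowHalfEdge h = t :=
  (P.existsUnique_singleTransition h).unique (P.mem_shadowHalfEdge h) ht

/-- A single transition consists of two distinct half-edges, incident on the same vertex. -/
theorem SingleTransition.exists_pair (t : P.SingleTransition) :
    ∃ a b : H, a ≠ b ∧ F.vert a = F.vert b ∧ t.1 = s(a, b) := by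
  obtain ⟨t, γ, -, c, -, p, hp, rfl⟩ := t
  exact ⟨p.1, p.2, c.fst_ne_snd hp hp, c.incident p hp, rfl⟩

/-- The vertex of `F` at which a single transition takes place. -/
noncomputable def SingleTransition.vertex {P : CircuitPartition F} (t : P.SingleTransition) : V :=
  F.vert (SingleTransition.exists_pair P t).choose

theorem SingleTransition.vertex_eq {P : CircuitPartition F} {t : P.SingleTransition} {h : H}
    (ht : h ∈ t.1) : t.vertex = F.vert h := by
  obtain ⟨b, -, h₁, h₂⟩ := (SingleTransition.exists_pair P t).choose_spec
  rw [h₂, Sym2.mem_iff] at ht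
  rcases ht with rfl | rfl
  · rfl
  · exact h₁

/-- The circuit of `P` to which a single transition belongs. -/
noncomputable def SingleTransition.circuit {P : CircuitPartition F} (t : P.SingleTransition) :
    P.circuits :=
  ⟨t.2.choose, t.2.choose_spec.1⟩

/-- In a 4-regular graph, `P` has exactly two single transitions at each vertex. -/
theorem ncard_singleTransition (hF : F.IsFourRegular) (v : V) :
    {t : P.SingleTransition | t.vertex = v}.ncard = 2 := by
  classical
  have hfin : {h : H | F.vert h = v}.Finite :=
    Set.finite_of_ncard_ne_zero (by rw [hF v]; decide)
  set S : Finset H := hfin.toFinset with hS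
  have hScard : S.card = 4 := by rw [← hF v, Set.ncard_eq_toFinset_card _ hfin]
  have himg : {t : P.SingleTransition | t.vertex = v} =
      ((S.image P.shadowHalfEdge : Finset _) : Set P.SingleTransition) := by
    ext t
    simp only [Set.mem_ofPred_eq, Finset.coe_image, Set.mem_image, Finset.mem_coe, hS,
      Set.Finite.mem_toFinset]
    constructor
    · intro ht
      obtain ⟨a, b, -, -, htab⟩ := SingleTransition.exists_pair P t
      have ha : a ∈ t.1 := by rw [htab]; simp
      exact ⟨a, by rw [← SingleTransition.vertex_eq ha, ht], P.shadowHalfEdge_eq ha⟩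
    · rintro ⟨h, hh, rfl⟩
      rw [SingleTransition.vertex_eq (P.mem_shadowHalfEdge h), hh]
  rw [himg, Set.ncard_coe_finset]
  have hsum := Finset.card_eq_sum_card_image P.shadowHalfEdge S
  have hfib : ∀ t ∈ S.image P.shadowHalfEdge,
      (S.filter fun h => P.shadowHalfEdge h = t).card = 2 := by
    intro t ht
    obtain ⟨h, hh, rfl⟩ := Finset.mem_image.1 ht
    obtain ⟨a, b, hab, hv, htab⟩ := SingleTransition.exists_pair P (P.shadowHalfEdge h)
    have hmem : ∀ x, x ∈ (P.shadowHalfEdge h).1 ↔ x = a ∨ x = b := by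
      intro x; rw [htab, Sym2.mem_iff]
    have hvx : ∀ x, x ∈ (P.shadowHalfEdge h).1 → F.vert x = v := by
      intro x hx
      rw [← SingleTransition.vertex_eq hx,
        SingleTransition.vertex_eq (P.mem_shadowHalfEdge h)]
      simpa [hS] using hh
    have : (S.filter fun x => P.shadowHalfEdge x = P.shadowHalfEdge h) = {a, b} := by
      ext x
      rw [Finset.mem_filter, Finset.mem_insert, Finset.mem_singleton, ← hmem]
      constructor
      · rintro ⟨-, hx⟩
        exact hx ▸ P.mem_shadowHalfEdge x
      · intro hx
        exact ⟨by simpa [hS] using hvx x hx, P.shadowHalfEdge_eq hx⟩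
    rw [this, Finset.card_pair hab]
  rw [Finset.sum_congr rfl hfib, hScard] at hsum
  simp only [Finset.sum_const, smul_eq_mul] at hsum
  omega

/-- The touch-graph `Tch(P)`. Its vertices are the circuits of `P`, and it has one edge `e_v` for
each vertex `v` of `F`. The two half-edges of `e_v` are the two single transitions of `P` at `v`,
each of them incident on the circuit of `P` to which it belongs. -/
noncomputable def touchGraph (hF : F.IsFourRegular) :
    HalfEdgeGraph P.circuits V P.SingleTransition where
  vert := SingleTransition.circuit
  edge := SingleTransition.vertex
  two_halves := P.ncard_singleTransition hF

end CircuitPartition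

/-- The cyclic sequence of those terms of a cyclic sequence that satisfy `q`. -/
def cycleFilter {α : Type*} (q : α → Prop) [DecidablePred q] : Cycle α → Cycle α :=
  Quotient.map (List.filter fun a => decide (q a)) (by
    rintro l _ ⟨k, rfl⟩
    rw [List.rotate_eq_drop_append_take_mod, List.filter_append]
    conv_lhs => rw [← List.take_append_drop (k % l.length) l, List.filter_append]
    exact List.isRotated_append)

/-- A closed walk in a graph is recorded by the cyclic sequence of its steps:
the step `(s, s')` traverses an edge from its half-edge `s` to its half-edge `s'`.
`z_D(W)` tallies `+1` in the `e` coordinate each time the closed walk `W` traverses `e` in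
accordance with the direction of `e` in `D`, and `-1` each time `W` traverses `e` against it. -/
noncomputable def Orientation.z {G : HalfEdgeGraph V E H} (D : G.Orientation)
    (W : Cycle (H × H)) : E → ℤ :=
  open Classical in fun e =>
    (W.toMultiset.map fun s =>
      if G.edge s.1 = e then (if s.1 = D.init e then (1 : ℤ) else -1) else 0).sum

/-- The shadow in `Tch(P)` of an oriented circuit `c`, as the cyclic sequence of its steps: the
passage `(h, h')` of `c` through `v` gives a step along `e_v` from the shadow of `h` to the shadow
of `h'`, except that it gives no step if `{h, h'}` is a single transition of `P`. -/
noncomputable def CircuitPartition.shadow (P : CircuitPartition F) (c : OrientedCircuit F) :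
    Cycle (P.SingleTransition × P.SingleTransition) :=
  open Classical in
  (cycleFilter (fun p : H × H => ¬ ∃ γ ∈ P.circuits, s(p.1, p.2) ∈ γ.singleTransitions)
    c.passages).map (Prod.map P.shadowHalfEdge P.shadowHalfEdge)

/-- The matrix `M_{ℝ,Γ}(C, P, D)`, whose `v` row is `z_D` of the shadow of `C_Γ(v)`.
All of its entries are integers. -/
noncomputable def signedMatrix (hF : F.IsFourRegular) (C : EulerSystem F)
    (Γ : FundamentalCircuits C) (P : CircuitPartition F) (D : (P.touchGraph hF).Orientation) :
    Matrix V V ℤ :=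
  Matrix.of fun v => D.z (P.shadow (Γ.circuit v))

end HalfEdgeGraph

/-! ### Integer row operations -/

/-- The elementary row operations over `ℤ`: multiply a row by `-1`, or add an integer multiple of
one row to a different row. -/
inductive RowOp (n : Type*)
  | neg (i : n)
  | add (i j : n) (hij : i ≠ j) (k : ℤ)

/-- The effect of a row operation: `neg i` multiplies row `i` by `-1`, and `add i j _ k` adds `k`
times row `j` to row `i`. -/
def RowOp.apply {m n : Type*} [DecidableEq m] : RowOp m → Matrix m n ℤ → Matrix m n ℤ
  | .neg i, M => M.updateRow i (-M i)
  | .add i j _ k, M => M.updateRow i (M i + k • M j)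

/-- Perform a sequence of row operations, the first one in the list first. -/
def RowOp.applyAll {m n : Type*} [DecidableEq m] (ops : List (RowOp m)) (M : Matrix m n ℤ) :
    Matrix m n ℤ :=
  ops.foldl (fun N op => op.apply N) M

/-- `M` and `N` are row equivalent over `ℤ`: some sequence of row operations transforms `M`
into `N`. (Each operation is undone by operations of the same kind.) -/
def RowEquivalent {m n : Type*} [DecidableEq m] (M N : Matrix m n ℤ) : Prop :=
  ∃ ops : List (RowOp m), RowOp.applyAll ops M = N

/-! ### Row operations over the integers -/

namespace RowOp

variable {m n k : Type*} [DecidableEq m]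

/-! Replace an oriented circuit by its flow on half-edges: `+1` where it leaves a vertex, `-1` where
it arrives. The tally `z_D` of a shadow is linear in the flow, and the linear map (`initialMatrix`)
depends only on `P` and `D`. So every signed matrix factors as `flowMatrix * initialMatrix`, with a
left factor that depends only on the fundamental circuits (`signedMatrix_eq_mul`).

The rows of `flowMatrix` form a ℤ-basis of the integral circulations of `F` that vanish on the base
edges. Independence: summing over the two half-edges of a suitable transition of `C` at each vertex
gives dual functionals (`exists_dual`). Spanning: a circulation killed by all these functionals is,
by 4-regularity, opposite on both transitions of `C` at each vertex. It is then constant up to sign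
along each Euler circuit, and zero because each Euler circuit meets a base edge
(`eq_zero_of_mem_circulations`).

The circulations do not depend on the Euler system, so the two flow matrices differ by a left factor
`U` invertible over ℤ. By the Euclidean algorithm, left multiplication by `U` is a sequence of row
operations (`exists_applyAll_eq_mul`); chosen before `P` and `D`, it serves them all. -/

theorem apply_mul [Fintype n] (op : RowOp m) (M : Matrix m n ℤ) (N : Matrix n k ℤ) :
    op.apply (M * N) = op.apply M * N := by
  ext r s
  cases op with
  | neg i =>
    by_cases h : r = i
    · subst h; simp [apply, Matrix.mul_apply]
    · simp [apply, Matrix.mul_apply, h]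
  | add i j hij c =>
    by_cases h : r = i
    · subst h
      simp [apply, Matrix.mul_apply, add_mul, Finset.sum_add_distrib, Finset.mul_sum, mul_assoc]
    · simp [apply, Matrix.mul_apply, h]

theorem applyAll_append (l₁ l₂ : List (RowOp m)) (M : Matrix m n ℤ) :
    applyAll (l₁ ++ l₂) M = applyAll l₂ (applyAll l₁ M) :=
  List.foldl_append

/-- Row operations act on the left factor only; this lets one sequence, found on a square matrix, be
transported to any product. -/
theorem applyAll_mul [Fintype n] (ops : List (RowOp m)) (M : Matrix m n ℤ) (N : Matrix n k ℤ) :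
    applyAll ops (M * N) = applyAll ops M * N := by
  induction ops generalizing M with
  | nil => rfl
  | cons op ops ih =>
    change applyAll ops (op.apply (M * N)) = applyAll ops (op.apply M) * N
    rw [apply_mul, ih]

end RowOp

namespace RowEquivalent

variable {m n : Type*} [DecidableEq m] {M N K : Matrix m n ℤ}

theorem refl (M : Matrix m n ℤ) : RowEquivalent M M := ⟨[], rfl⟩

theorem trans : RowEquivalent M N → RowEquivalent N K → RowEquivalent M K := by
  rintro ⟨l₁, rfl⟩ ⟨l₂, rfl⟩
  exact ⟨l₁ ++ l₂, RowOp.applyAll_append _ _ _⟩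

theorem neg (M : Matrix m n ℤ) (i : m) : RowEquivalent M (M.updateRow i (-M i)) :=
  ⟨[.neg i], rfl⟩

theorem add (M : Matrix m n ℤ) {i j : m} (hij : i ≠ j) (c : ℤ) :
    RowEquivalent M (M.updateRow i (M i + c • M j)) :=
  ⟨[.add i j hij c], rfl⟩

/-- Row equivalence preserves the existence of a left inverse. -/
theorem exists_left_inverse [Fintype m] [Fintype n] [DecidableEq n] (h : RowEquivalent M N)
    (hM : ∃ L : Matrix n m ℤ, L * M = 1) : ∃ L : Matrix n m ℤ, L * N = 1 := by
  obtain ⟨ops, rfl⟩ := h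
  induction ops generalizing M with
  | nil => exact hM
  | cons op ops ih =>
    refine ih ?_
    obtain ⟨L, hL⟩ := hM
    -- An elementary matrix is inverted by one of the same kind: `neg` is an involution, and `add`
    -- is undone by the opposite multiple.
    obtain ⟨S, hS⟩ : ∃ S : Matrix m m ℤ, S * op.apply (1 : Matrix m m ℤ) = 1 := by
      cases op with
      | neg i =>
        refine ⟨(RowOp.neg i).apply 1, ?_⟩
        rw [← RowOp.apply_mul, one_mul]
        ext r s
        by_cases h : r = i
        · subst h; simp [RowOp.apply]
        · simp [RowOp.apply, h]
      | add i j hij c =>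
        refine ⟨(RowOp.add i j hij (-c)).apply 1, ?_⟩
        rw [← RowOp.apply_mul, one_mul]
        ext r s
        by_cases h : r = i
        · subst h; simp [RowOp.apply, hij.symm]
        · simp [RowOp.apply, h]
    refine ⟨L * S, ?_⟩
    have : op.apply M = op.apply (1 : Matrix m m ℤ) * M := by
      rw [← RowOp.apply_mul, Matrix.one_mul]
    change L * S * op.apply M = 1
    rw [this, Matrix.mul_assoc, ← Matrix.mul_assoc S, hS, Matrix.one_mul, hL]

end RowEquivalent

/-! ### Reducing invertible integer matrices to the identity -/

namespace Matrix

variable {n : Type*} [DecidableEq n]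

/-- The columns of `M` in `s` agree with those of the identity matrix. -/
def IsOneOnColumns (M : Matrix n n ℤ) (s : Finset n) : Prop :=
  ∀ k ∈ s, ∀ i, M i k = (1 : Matrix n n ℤ) i k

/-- A row with index outside `s` is zero in the columns of `s`, so adding it anywhere leaves those
columns alone. -/
theorem IsOneOnColumns.add {M : Matrix n n ℤ} {s : Finset n} (hM : M.IsOneOnColumns s) (i : n)
    {j : n} (hj : j ∉ s) (c : ℤ) : (M.updateRow i (M i + c • M j)).IsOneOnColumns s := by
  intro k hk r
  have hjk : j ≠ k := fun h => hj (h ▸ hk)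
  by_cases h : r = i
  · subst h; simp [hM k hk, hjk]
  · simp [h, hM k hk]

theorem IsOneOnColumns.neg {M : Matrix n n ℤ} {s : Finset n} (hM : M.IsOneOnColumns s) {i : n}
    (hi : i ∉ s) : (M.updateRow i (-M i)).IsOneOnColumns s := by
  intro k hk r
  have hik : i ≠ k := fun h => hi (h ▸ hk)
  by_cases h : r = i
  · subst h; simp [hM k hk, hik]
  · simp [h, hM k hk]

/-- Clearing the entries of a column other than the pivot. -/
theorem exists_rowEquivalent_clear (s t : Finset n) (j : n) (hj : j ∉ s) (hjt : j ∉ t)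
    (M : Matrix n n ℤ) (hM : M.IsOneOnColumns s) (h1 : M j j = 1) :
    ∃ N : Matrix n n ℤ, RowEquivalent M N ∧ N.IsOneOnColumns s ∧ N j j = 1 ∧
      ∀ i ∈ t, N i j = 0 := by
  induction t using Finset.induction_on with
  | empty => exact ⟨M, .refl M, hM, h1, by simp⟩
  | insert a t ha ih =>
    rw [Finset.mem_insert, not_or] at hjt
    obtain ⟨N, hMN, hN, hN1, hNt⟩ := ih hjt.2
    refine ⟨_, hMN.trans (RowEquivalent.add N (Ne.symm hjt.1) (-N a j)), hN.add a hj _, ?_, ?_⟩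
    · simp [hjt.1, hN1]
    · intro i hi
      by_cases h : i = a
      · subst h; simp [hN1]
      · simp [h, hNt i ((Finset.mem_insert.1 hi).resolve_left h)]

variable [Fintype n]

/-- The Euclidean algorithm on the entries of a column outside of `s`. -/
theorem exists_rowEquivalent_subsingleton (s : Finset n) (j : n) (M : Matrix n n ℤ)
    (hM : M.IsOneOnColumns s) :
    ∃ N : Matrix n n ℤ, RowEquivalent M N ∧ N.IsOneOnColumns s ∧
      ∀ i ∉ s, ∀ k ∉ s, N i j ≠ 0 → N k j ≠ 0 → i = k := by
  -- The decreasing measure is the sum of the absolute values in column `j` over the rows outside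
  -- `s`.
  induction hd : ∑ i ∈ sᶜ, (M i j).natAbs using Nat.strong_induction_on generalizing M with
  | _ d ih =>
    by_cases hc : ∀ i ∉ s, ∀ k ∉ s, M i j ≠ 0 → M k j ≠ 0 → i = k
    · exact ⟨M, .refl M, hM, hc⟩
    push Not at hc
    obtain ⟨i, hi, k, hk, hi0, hk0, hik⟩ := hc
    wlog hle : (M k j).natAbs ≤ (M i j).natAbs generalizing i k
    · exact this k hk i hi hk0 hi0 hik.symm (by omega)
    -- Both entries are nonzero, so adding or subtracting the smaller one, according to signs,
    -- strictly shrinks the larger.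
    obtain ⟨c, hcc⟩ : ∃ c : ℤ, (M i j + c * M k j).natAbs < (M i j).natAbs := by
      by_cases h1 : 0 < M i j <;> by_cases h2 : 0 < M k j
      · exact ⟨-1, by omega⟩
      · exact ⟨1, by omega⟩
      · exact ⟨1, by omega⟩
      · exact ⟨-1, by omega⟩
    obtain ⟨N, h₁, h₂, h₃⟩ := ih _ (by
      rw [← hd]
      refine Finset.sum_lt_sum (fun r _ => ?_) ⟨i, by simpa using hi, ?_⟩ (f := fun r =>
        ((M.updateRow i (M i + c • M k)) r j).natAbs)
      · by_cases h : r = i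
        · subst h; simpa using hcc.le
        · simp [h]
      · simpa using hcc) _ (hM.add i hk c) rfl
    exact ⟨N, (RowEquivalent.add M hik c).trans h₁, h₂, h₃⟩

/-- After the Euclidean step, column `j` has at most one nonzero entry outside `s`. Row `j` of a
left inverse vanishes on `s`, so its product with column `j` reduces to that entry times an integer;
as the product is `1`, the entry is `±1` and can serve as pivot. -/
theorem exists_rowEquivalent_insert (s : Finset n) (j : n) (hj : j ∉ s) (M : Matrix n n ℤ)
    (hM : M.IsOneOnColumns s) (hinv : ∃ L : Matrix n n ℤ, L * M = 1) :
    ∃ N : Matrix n n ℤ, RowEquivalent M N ∧ N.IsOneOnColumns (insert j s) := by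
  obtain ⟨N, hMN, hN, hsub⟩ := exists_rowEquivalent_subsingleton s j M hM
  obtain ⟨L, hL⟩ := hMN.exists_left_inverse hinv
  -- Column `k` of `N` is a unit vector, so `L j k` is the `(j, k)` entry of `L * N = 1`.
  have hLs : ∀ k ∈ s, L j k = 0 := by
    intro k hk
    have hjk : j ≠ k := fun h => hj (h ▸ hk)
    have := congrFun (congrFun hL j) k
    rw [mul_apply, one_apply_ne hjk] at this
    simpa [hN k hk, one_apply] using this
  have key := congrFun (congrFun hL j) j
  obtain ⟨k, hk, hk0⟩ : ∃ k ∉ s, N k j ≠ 0 := by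
    by_contra! h0
    rw [mul_apply, one_apply_eq, Finset.sum_eq_zero] at key
    · exact zero_ne_one key
    · intro i _
      by_cases hi : i ∈ s
      · simp [hLs i hi]
      · simp [h0 i hi]
  have hunit : IsUnit (N k j) := by
    rw [mul_apply, one_apply_eq, Finset.sum_eq_single k] at key
    · exact IsUnit.of_mul_eq_one_right _ key
    · intro i _ hik
      by_cases hi : i ∈ s
      · simp [hLs i hi]
      · by_contra h
        exact hik (hsub i hi k hk (right_ne_zero_of_mul h) hk0)
    · simp
  obtain ⟨N₁, hNN₁, hN₁, h1⟩ : ∃ N₁ : Matrix n n ℤ, RowEquivalent N N₁ ∧ N₁.IsOneOnColumns s ∧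
      N₁ j j = 1 := by
    by_cases hkj : k = j
    · subst hkj
      rcases Int.isUnit_iff.1 hunit with h | h
      · exact ⟨N, .refl N, hN, h⟩
      · exact ⟨_, .neg N k, hN.neg hk, by simp [h]⟩
    · have hj0 : N j j = 0 := by
        by_contra h
        exact hkj (hsub k hk j hj hk0 h)
      -- No row swap is needed: row `j` has a zero in this column, and adding `N k j` times row `k`
      -- puts `(±1)² = 1` there.
      refine ⟨_, .add N (Ne.symm hkj) (N k j), hN.add j hk _, ?_⟩
      rcases Int.isUnit_iff.1 hunit with h | h <;> simp [h, hj0]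
  obtain ⟨N₂, h₁₂, hN₂, h2, hz⟩ :=
    exists_rowEquivalent_clear s (Finset.univ.erase j) j hj (by simp) N₁ hN₁ h1
  refine ⟨N₂, (hMN.trans hNN₁).trans h₁₂, fun c hc i => ?_⟩
  rcases Finset.mem_insert.1 hc with rfl | hc
  · by_cases h : i = c
    · subst h; simp [h2]
    · rw [hz i (by simp [h]), one_apply_ne h]
  · exact hN₂ c hc i

theorem rowEquivalent_one {M : Matrix n n ℤ} (hinv : ∃ L : Matrix n n ℤ, L * M = 1) :
    RowEquivalent M 1 := by
  suffices ∀ s : Finset n, ∃ N : Matrix n n ℤ, RowEquivalent M N ∧ N.IsOneOnColumns s by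
    obtain ⟨N, hMN, hN⟩ := this Finset.univ
    have : N = 1 := by ext i k; exact hN k (Finset.mem_univ k) i
    rwa [this] at hMN
  intro s
  induction s using Finset.induction_on with
  | empty => exact ⟨M, .refl M, by simp [IsOneOnColumns]⟩
  | insert j s hj ih =>
    obtain ⟨N, hMN, hN⟩ := ih
    obtain ⟨K, hNK, hK⟩ :=
      exists_rowEquivalent_insert s j hj N hN (hMN.exists_left_inverse hinv)
    exact ⟨K, hMN.trans hNK, hK⟩

/-- Multiplication by an invertible integer matrix is realized by a sequence of row operations. -/
theorem exists_applyAll_eq_mul {U L : Matrix n n ℤ} (h : U * L = 1) :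
    ∃ ops : List (RowOp n), ∀ M : Matrix n n ℤ, RowOp.applyAll ops M = U * M := by
  -- The matrix reduced to the identity is `L`, not `U`: the sequence then turns `M = L * (U * M)`
  -- into `U * M`.
  obtain ⟨ops, hops⟩ := rowEquivalent_one ⟨U, h⟩
  refine ⟨ops, fun M => ?_⟩
  have hL : L * U = 1 := mul_eq_one_comm.1 h
  calc RowOp.applyAll ops M = RowOp.applyAll ops (L * (U * M)) := by
        rw [← Matrix.mul_assoc, hL, Matrix.one_mul]
    _ = U * M := by rw [RowOp.applyAll_mul, hops, Matrix.one_mul]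

end Matrix

/-! ### Finiteness and components -/

namespace HalfEdgeGraph

variable {V E H : Type*} {F : HalfEdgeGraph V E H}

theorem IsFourRegular.finite_halfEdges [Finite V] (hF : F.IsFourRegular) : Finite H := by
  have h : (⋃ v : V, {h : H | F.vert h = v}).Finite :=
    -- `Set.ncard` is `0` on infinite sets, so the value `4` forces finiteness.
    Set.finite_iUnion fun v => Set.finite_of_ncard_ne_zero (by rw [hF v]; decide)
  exact Set.finite_univ_iff.1 (h.subset fun h _ => Set.mem_iUnion.2 ⟨F.vert h, rfl⟩)

theorem edgeInComponent_iff {h : H} {K : F.Component} :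
    F.EdgeInComponent (F.edge h) K ↔ F.adjacency.connectedComponentMk (F.vert h) = K := by
  refine ⟨fun hK => hK h rfl, ?_⟩
  rintro rfl h' he
  -- `SimpleGraph` adjacency is irreflexive, so loops are treated separately.
  by_cases hv : F.vert h' = F.vert h
  · rw [hv]
  · refine SimpleGraph.ConnectedComponent.sound (SimpleGraph.Adj.reachable ?_)
    exact (SimpleGraph.fromRel_adj _ _ _).2 ⟨hv, Or.inl ⟨h', h, he, rfl, rfl⟩⟩

theorem exists_edge_eq (F : HalfEdgeGraph V E H) (e : E) : ∃ h : H, F.edge h = e :=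
  Set.nonempty_of_ncard_ne_zero (s := {h : H | F.edge h = e}) (by rw [F.two_halves e]; decide)

/-! ### Flows of oriented circuits -/

namespace OrientedCircuit

/-- The flow of an oriented circuit: `1` on the half-edges on which it leaves a vertex, `-1` on
the half-edges on which it arrives at a vertex, and `0` elsewhere. -/
noncomputable def flow (c : OrientedCircuit F) (h : H) : ℤ :=
  open Classical in
  (c.passages.toMultiset.map Prod.snd).count h - (c.passages.toMultiset.map Prod.fst).count h

variable (c : OrientedCircuit F)

theorem flow_snd {p : H × H} (hp : p ∈ c.passages) : c.flow p.2 = 1 := by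
  classical
  obtain ⟨-, n₂, -⟩ := Multiset.nodup_add.1 c.nodup
  have h₁ := Multiset.count_eq_one_of_mem n₂ (Multiset.mem_map_of_mem _ (toMultiset_mem.2 hp))
  have h₂ : p.2 ∉ c.passages.toMultiset.map Prod.fst := by
    rw [Multiset.mem_map]
    rintro ⟨q, hq, hqp⟩
    exact c.fst_ne_snd (toMultiset_mem.1 hq) hp hqp
  have h₃ := Multiset.count_eq_zero_of_notMem h₂
  unfold flow
  convert (by norm_num : ((1 : ℕ) : ℤ) - (0 : ℕ) = 1)

theorem flow_fst {p : H × H} (hp : p ∈ c.passages) : c.flow p.1 = -1 := by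
  classical
  obtain ⟨n₁, -, -⟩ := Multiset.nodup_add.1 c.nodup
  have h₁ := Multiset.count_eq_one_of_mem n₁ (Multiset.mem_map_of_mem _ (toMultiset_mem.2 hp))
  have h₂ : p.1 ∉ c.passages.toMultiset.map Prod.snd := by
    rw [Multiset.mem_map]
    rintro ⟨q, hq, hqp⟩
    exact c.fst_ne_snd hp (toMultiset_mem.1 hq) hqp.symm
  have h₃ := Multiset.count_eq_zero_of_notMem h₂
  unfold flow
  convert (by norm_num : ((0 : ℕ) : ℤ) - (1 : ℕ) = -1)

theorem flow_eq_zero {h : H} (hh : ∀ p ∈ c.passages, h ∉ s(p.1, p.2)) : c.flow h = 0 := by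
  classical
  have h₁ : h ∉ c.passages.toMultiset.map Prod.fst := by
    rw [Multiset.mem_map]
    rintro ⟨p, hp, rfl⟩
    exact hh p (toMultiset_mem.1 hp) (by simp)
  have h₂ : h ∉ c.passages.toMultiset.map Prod.snd := by
    rw [Multiset.mem_map]
    rintro ⟨p, hp, rfl⟩
    exact hh p (toMultiset_mem.1 hp) (by simp)
  have h₃ := Multiset.count_eq_zero_of_notMem h₁
  have h₄ := Multiset.count_eq_zero_of_notMem h₂
  unfold flow
  convert (by norm_num : ((0 : ℕ) : ℤ) - (0 : ℕ) = 0)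

theorem flow_add_flow_of_mem {p : H × H} (hp : p ∈ c.passages) : c.flow p.1 + c.flow p.2 = 0 := by
  rw [c.flow_fst hp, c.flow_snd hp]; norm_num

/-- Turns tallies over passages into linear functions of the flow; both the vertex law for
circulations and the formula for `z_D` come from it. -/
theorem sum_flow_mul [Fintype H] (g : H → ℤ) :
    ∑ h, c.flow h * g h = (c.passages.toMultiset.map fun p => g p.2 - g p.1).sum := by
  classical
  have key : ∀ s : Multiset H, ∑ h, (s.count h : ℤ) * g h = (s.map g).sum := by
    intro s
    rw [Finset.sum_multiset_map_count]
    simp only [nsmul_eq_mul]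
    symm
    refine Finset.sum_subset (Finset.subset_univ _) fun h _ hh => ?_
    rw [Multiset.count_eq_zero_of_notMem (by simpa using hh)]
    simp
  have : ∀ h, c.flow h * g h = ((c.passages.toMultiset.map Prod.snd).count h : ℤ) * g h -
      ((c.passages.toMultiset.map Prod.fst).count h : ℤ) * g h := by
    intro h
    rw [← sub_mul]
    unfold flow
    congr!
  simp only [this, Finset.sum_sub_distrib, key, Multiset.map_map, Function.comp_def,
    Multiset.sum_map_sub]

theorem includesEdge_of_mem_passage {p : H × H} (hp : p ∈ c.passages) {h : H}
    (hh : h ∈ s(p.1, p.2)) : c.IncludesEdge (F.edge h) := by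
  rw [Sym2.mem_iff] at hh
  rcases hh with rfl | rfl
  · obtain ⟨q, hq, he⟩ := c.exists_prev hp
    exact ⟨q, hq, he⟩
  · exact ⟨p, hp, rfl⟩

theorem flow_eq_zero_of_not_includesEdge {h : H} (hh : ¬ c.IncludesEdge (F.edge h)) :
    c.flow h = 0 :=
  c.flow_eq_zero fun _ hp hm => hh (c.includesEdge_of_mem_passage hp hm)

theorem flow_add_flow_of_edge_eq {h h' : H} (hne : h ≠ h') (he : F.edge h = F.edge h') :
    c.flow h + c.flow h' = 0 := by
  by_cases hc : c.IncludesEdge (F.edge h)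
  · obtain ⟨p, hp, hpe⟩ := hc
    obtain ⟨q, hq, hqe⟩ := c.exists_next hp
    have hqp := c.fst_ne_snd hq hp
    rcases eq_or_eq_of_edge_eq (h := h) hqp hqe.symm hpe.symm with rfl | rfl <;>
    rcases eq_or_eq_of_edge_eq (h := h') hqp hqe.symm (he.symm.trans hpe.symm) with rfl | rfl
    · exact absurd rfl hne
    · rw [c.flow_fst hq, c.flow_snd hp]; norm_num
    · rw [c.flow_fst hq, c.flow_snd hp]; norm_num
    · exact absurd rfl hne
  · rw [c.flow_eq_zero_of_not_includesEdge hc, c.flow_eq_zero_of_not_includesEdge (he ▸ hc),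
      add_zero]

/-- A function that is opposite on the two halves of every edge and on the two half-edges of every
passage of a circuit is constant, up to sign, along that circuit. -/
theorem apply_snd_eq {b : H → ℤ}
    (hedge : ∀ h h' : H, h ≠ h' → F.edge h = F.edge h' → b h + b h' = 0)
    (hpass : ∀ p ∈ c.passages, b p.1 + b p.2 = 0) {p q : H × H} (hp : p ∈ c.passages)
    (hq : q ∈ c.passages) : b p.2 = b q.2 := by
  have hchain : c.passages.Chain fun p q => b p.2 = b q.2 := by
    have hc := c.chain
    have hne : ∀ p ∈ c.passages, ∀ q ∈ c.passages, p.2 ≠ q.1 :=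
      fun p hp q hq => (c.fst_ne_snd hq hp).symm
    generalize c.passages = s at hc hne hpass
    induction s using Quotient.inductionOn'
    rename_i l
    cases l with
    | nil => trivial
    | cons a l =>
      change Cycle.Chain _ ((a :: l : List (H × H)) : Cycle (H × H)) at hc
      change Cycle.Chain _ ((a :: l : List (H × H)) : Cycle (H × H))
      rw [Cycle.chain_coe_cons] at hc ⊢
      refine hc.imp_of_mem_imp fun x y hx hy hxy => ?_
      have hx : x ∈ a :: l := by simp at hx ⊢; tauto
      have hy : y ∈ a :: l := by simp at hy ⊢; tauto
      -- Crossing the edge changes the sign of `b`, and so does the passage `y`; the two changes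
      -- cancel.
      have h₁ := hedge _ _ (hne x hx y hy) hxy
      have h₂ := hpass y hy
      linarith
  have : IsTrans (H × H) fun p q => b p.2 = b q.2 := ⟨fun _ _ _ => Eq.trans⟩
  exact Cycle.chain_iff_pairwise.1 hchain p hp q hq

end OrientedCircuit

/-! ### Circulations -/

/-- The integral circulations of `F` that vanish on the edges in `B`: the functions on half-edges
that are opposite on the two halves of every edge, whose values sum to zero at every vertex, and
that are zero on `B`. -/
def circulations [Fintype H] (F : HalfEdgeGraph V E H) (B : Set E) : Submodule ℤ (H → ℤ) where
  carrier := {b | (∀ h h' : H, h ≠ h' → F.edge h = F.edge h' → b h + b h' = 0) ∧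
    (∀ g : V → ℤ, ∑ h, b h * g (F.vert h) = 0) ∧ ∀ h, F.edge h ∈ B → b h = 0}
  add_mem' := by
    rintro a b ⟨a₁, a₂, a₃⟩ ⟨b₁, b₂, b₃⟩
    refine ⟨fun h h' hne he => ?_, fun g => ?_, fun h hh => ?_⟩
    · have := a₁ h h' hne he
      have := b₁ h h' hne he
      simp only [Pi.add_apply]
      linarith
    · simp only [Pi.add_apply, add_mul, Finset.sum_add_distrib, a₂ g, b₂ g, add_zero]
    · simp [a₃ h hh, b₃ h hh]
  zero_mem' := by simp
  smul_mem' := by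
    rintro k a ⟨a₁, a₂, a₃⟩
    refine ⟨fun h h' hne he => ?_, fun g => ?_, fun h hh => ?_⟩
    · simp only [Pi.smul_apply, smul_eq_mul, ← mul_add, a₁ h h' hne he, mul_zero]
    · simp only [Pi.smul_apply, smul_eq_mul, mul_assoc, ← Finset.mul_sum, a₂ g, mul_zero]
    · simp [a₃ h hh]

/-- The vertex law holds passage by passage: a passage arrives at and leaves the same vertex, so it
contributes zero against any test function `g` on vertices. -/
theorem OrientedCircuit.flow_mem_circulations [Fintype H] (c : OrientedCircuit F) {B : Set E}
    (hB : ∀ e ∈ B, ¬ c.IncludesEdge e) : c.flow ∈ F.circulations B := by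
  refine ⟨fun h h' => c.flow_add_flow_of_edge_eq, fun g => ?_,
    fun h hh => c.flow_eq_zero_of_not_includesEdge (hB _ hh)⟩
  rw [c.sum_flow_mul fun h => g (F.vert h)]
  refine Multiset.sum_eq_zero fun x hx => ?_
  obtain ⟨p, hp, rfl⟩ := Multiset.mem_map.1 hx
  rw [c.incident p (toMultiset_mem.1 hp), sub_self]

/-! ### Transitions of circuit partitions and Euler systems -/

namespace CircuitPartition

variable (P : CircuitPartition F)

/-- The two half-edges `h` and `h'` are consecutive on a circuit of `P`. -/
def IsTransition (h h' : H) : Prop :=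
  ∃ γ ∈ P.circuits, s(h, h') ∈ γ.singleTransitions

variable {P}

theorem isTransition_of_mem {c : OrientedCircuit F} (hc : c.toCircuit ∈ P.circuits) {p : H × H}
    (hp : p ∈ c.passages) : P.IsTransition p.1 p.2 :=
  ⟨_, hc, c, rfl, p, hp, rfl⟩

theorem IsTransition.symm {h h' : H} (ht : P.IsTransition h h') : P.IsTransition h' h := by
  unfold IsTransition at *
  rwa [Sym2.eq_swap]

theorem IsTransition.unique {h a b : H} (ha : P.IsTransition h a) (hb : P.IsTransition h b) :
    a = b := by
  have := (P.existsUnique_singleTransition h).unique (y₁ := ⟨s(h, a), ha⟩) (y₂ := ⟨s(h, b), hb⟩)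
    (by simp) (by simp)
  exact Sym2.congr_right.1 (congrArg Subtype.val this)

theorem IsTransition.ne {h h' : H} (ht : P.IsTransition h h') : h ≠ h' := by
  obtain ⟨a, b, hab, -, h₁⟩ := SingleTransition.exists_pair P ⟨s(h, h'), ht⟩
  rcases Sym2.eq_iff.1 h₁ with ⟨rfl, rfl⟩ | ⟨rfl, rfl⟩
  exacts [hab, hab.symm]

theorem IsTransition.vert_eq {h h' : H} (ht : P.IsTransition h h') : F.vert h = F.vert h' := by
  obtain ⟨a, b, -, hab, h₁⟩ := SingleTransition.exists_pair P ⟨s(h, h'), ht⟩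
  rcases Sym2.eq_iff.1 h₁ with ⟨rfl, rfl⟩ | ⟨rfl, rfl⟩
  exacts [hab, hab.symm]

/-- The passages omitted from a shadow are thus those whose two half-edges have equal shadows, where
a difference of values on shadows vanishes anyway. -/
theorem isTransition_iff_shadowHalfEdge_eq {h h' : H} (hne : h ≠ h') :
    P.IsTransition h h' ↔ P.shadowHalfEdge h = P.shadowHalfEdge h' := by
  constructor
  · intro ht
    rw [P.shadowHalfEdge_eq (h := h) (t := ⟨s(h, h'), ht⟩) (by simp),
      P.shadowHalfEdge_eq (h := h') (t := ⟨s(h, h'), ht⟩) (by simp)]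
  · intro hs
    have h₁ := P.mem_shadowHalfEdge h
    have h₂ := P.mem_shadowHalfEdge h'
    rw [← hs] at h₂
    have h₃ := (P.shadowHalfEdge h).2
    rwa [(Sym2.mem_and_mem_iff hne).1 ⟨h₁, h₂⟩] at h₃

/-- In a 4-regular graph, if the values of `b` sum to zero at a vertex and `b` is opposite on the
two half-edges of one of the transitions there, then it is opposite on those of the other. -/
theorem IsTransition.add_eq_zero [Fintype H] (hF : F.IsFourRegular) {b : H → ℤ}
    (hb : ∀ g : V → ℤ, ∑ h, b h * g (F.vert h) = 0) {h₁ h₂ h h' : H}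
    (ht₀ : P.IsTransition h₁ h₂) (h0 : b h₁ + b h₂ = 0) (ht : P.IsTransition h h')
    (hv : F.vert h₁ = F.vert h) : b h + b h' = 0 := by
  classical
  by_cases e₁ : h = h₁
  · subst e₁; rwa [ht.unique ht₀]
  by_cases e₂ : h = h₂
  · subst e₂; rw [ht.unique ht₀.symm]; linarith
  have e₃ : h' ≠ h₁ := by rintro rfl; exact e₂ (ht.symm.unique ht₀)
  have e₄ : h' ≠ h₂ := by rintro rfl; exact e₁ (ht.symm.unique ht₀.symm)
  have hset : (Finset.univ.filter fun x => F.vert x = F.vert h) = {h₁, h₂, h, h'} := by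
    symm
    refine Finset.eq_of_subset_of_card_le ?_ ?_
    · intro x hx
      simp only [Finset.mem_insert, Finset.mem_singleton] at hx
      rw [Finset.mem_filter]
      refine ⟨Finset.mem_univ _, ?_⟩
      rcases hx with rfl | rfl | rfl | rfl
      exacts [hv, ht₀.vert_eq ▸ hv, rfl, ht.vert_eq.symm]
    · have h4 := hF (F.vert h)
      rw [Set.ncard_eq_toFinset_card'] at h4
      rw [Finset.card_insert_of_notMem (by simp [ht₀.ne, Ne.symm e₁, e₃.symm]),
        Finset.card_insert_of_notMem (by simp [Ne.symm e₂, e₄.symm]), Finset.card_pair ht.ne]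
      refine le_of_eq (Eq.trans ?_ h4)
      congr 1
      ext x
      simp
  -- The indicator of the vertex as test function isolates the sum over its four half-edges.
  have := hb fun v => if v = F.vert h then 1 else 0
  simp only [mul_ite, mul_one, mul_zero] at this
  rw [← Finset.sum_filter, hset, Finset.sum_insert (by simp [ht₀.ne, Ne.symm e₁, e₃.symm]),
    Finset.sum_insert (by simp [Ne.symm e₂, e₄.symm]), Finset.sum_pair ht.ne] at this
  linarith

end CircuitPartition

namespace EulerSystem

/-- An Euler system is a circuit partition. -/
def toCircuitPartition (C : EulerSystem F) : CircuitPartition F where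
  circuits := C.circuits
  existsUnique e := by
    obtain ⟨h, rfl⟩ := F.exists_edge_eq e
    obtain ⟨γ, ⟨hγ, hγK⟩, huniq⟩ :=
      C.existsUnique (F.adjacency.connectedComponentMk (F.vert h))
    refine ⟨γ, ⟨hγ, (hγK _).2 (edgeInComponent_iff.2 rfl)⟩, ?_⟩
    rintro γ' ⟨hγ', he⟩
    obtain ⟨K, hK⟩ := C.isEuler γ' hγ'
    refine huniq γ' ⟨hγ', ?_⟩
    rwa [edgeInComponent_iff.1 ((hK _).1 he)]

/-- A circulation that vanishes on a set of base edges and is opposite on the half-edges of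
one transition of an Euler system at each vertex is zero. -/
theorem eq_zero_of_mem_circulations [Fintype H] (C : EulerSystem F) (hF : F.IsFourRegular)
    {B : Set E} (hB : F.IsBaseEdgeSet B) {b : H → ℤ} (hb : b ∈ F.circulations B)
    (h0 : ∀ v : V, ∃ h₁ h₂ : H, C.toCircuitPartition.IsTransition h₁ h₂ ∧ F.vert h₁ = v ∧
      b h₁ + b h₂ = 0) : b = 0 := by
  obtain ⟨hb₁, hb₂, hb₃⟩ := hb
  have hT : ∀ h h' : H, C.toCircuitPartition.IsTransition h h' → b h + b h' = 0 := by
    intro h h' ht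
    obtain ⟨h₁, h₂, ht₀, hv, h0⟩ := h0 (F.vert h)
    exact ht₀.add_eq_zero hF hb₂ h0 ht hv
  funext h
  obtain ⟨γ, ⟨hγ, hγK⟩, -⟩ := C.existsUnique (F.adjacency.connectedComponentMk (F.vert h))
  obtain ⟨e, ⟨heB, heK⟩, -⟩ := hB (F.adjacency.connectedComponentMk (F.vert h))
  induction γ using Quotient.inductionOn
  rename_i c
  have hinc : ∀ e, F.EdgeInComponent e (F.adjacency.connectedComponentMk (F.vert h)) →
      ∀ x, F.edge x = e → ∃ p ∈ c.passages, x ∈ s(p.1, p.2) := by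
    rintro e he x rfl
    -- Inclusion may be witnessed by the other orientation `c'`; its passages are carried back to
    -- `c`.
    obtain ⟨c', hc', hi⟩ := (hγK _).2 he
    obtain ⟨p, hp, hx⟩ := c'.exists_passage hi
    obtain ⟨q, hq, hqp⟩ := OrientedCircuit.exists_passage_of_toCircuit_eq hc' hp
    exact ⟨q, hq, hqp ▸ hx⟩
  have hpass : ∀ p ∈ c.passages, b p.1 + b p.2 = 0 := fun p hp =>
    hT _ _ (CircuitPartition.isTransition_of_mem (P := C.toCircuitPartition) (c := c) hγ hp)
  obtain ⟨x, rfl⟩ := F.exists_edge_eq e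
  obtain ⟨p, hp, hx⟩ := hinc _ heK x rfl
  obtain ⟨q, hq, hh⟩ := hinc _ (edgeInComponent_iff.2 rfl) h rfl
  -- Both `h` and the base half-edge `x` lie on `c`, so `b h = ± b x = 0`.
  have hpq := c.apply_snd_eq hb₁ hpass hp hq
  have h₁ := hpass p hp
  have h₂ := hpass q hq
  have h₃ := hb₃ x heB
  rw [Sym2.mem_iff] at hx hh
  change b h = 0
  rcases hx with rfl | rfl <;> rcases hh with rfl | rfl <;> linarith

end EulerSystem

/-! ### Fundamental circuits -/

/-- At a vertex `v`, the flow of a fundamental circuit sums to `1` on a transition of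
the Euler system, and it sums to `0` on the transitions at the other vertices. -/
theorem OrientedCircuit.FollowsFrom.exists_transition {P : CircuitPartition F}
    {f c : OrientedCircuit F} {v : V} (hf : f.FollowsFrom c v) (hc : c.toCircuit ∈ P.circuits) :
    (∃ h₁ h₂ : H, P.IsTransition h₁ h₂ ∧ F.vert h₁ = v ∧ f.flow h₁ + f.flow h₂ = 1) ∧
      ∀ h h' : H, P.IsTransition h h' → F.vert h ≠ v → f.flow h + f.flow h' = 0 := by
  obtain ⟨h₁, h₂, h₃, h₄, A, B, hv₂, hv₃, hcp, hfp⟩ := hf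
  have memA : ∀ p ∈ A, p ∈ c.passages := by
    intro p hp; rw [hcp]; simp [hp]
  have memf : ∀ {p}, p ∈ f.passages ↔ p = (h₃, h₂) ∨ p ∈ A := by
    intro p; rw [hfp]; simp
  have m₁ : (h₁, h₂) ∈ c.passages := by rw [hcp]; simp
  have m₃ : (h₃, h₄) ∈ c.passages := by rw [hcp]; simp
  have hnd := c.nodup
  rw [hcp] at hnd
  have hnd₁ := (Multiset.nodup_add.1 hnd).1
  simp only [Cycle.coe_toMultiset, Multiset.map_coe, Multiset.coe_nodup, List.map_cons,
    List.map_append, List.nodup_cons, List.mem_append, List.mem_cons, not_or] at hnd₁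
  -- The transition `{h₁, h₂}` of `c` is split by `f`: it leaves on `h₂` but arrives on `h₃`, so the
  -- flow is `1` on `h₂` and `0` on `h₁`.
  refine ⟨⟨h₁, h₂, CircuitPartition.isTransition_of_mem hc m₁, ?_, ?_⟩, ?_⟩
  · exact (c.incident _ m₁).trans hv₂
  · rw [f.flow_eq_zero, f.flow_snd (p := (h₃, h₂)) (memf.2 (Or.inl rfl)), zero_add]
    intro p hp hm
    rw [Sym2.mem_iff] at hm
    rcases memf.1 hp with rfl | hA
    · rcases hm with hm | hm
      · exact hnd₁.1.2.1 hm
      · exact c.fst_ne_snd m₁ m₁ hm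
    · rcases hm with hm | hm
      · exact hnd₁.1.1 (List.mem_map.2 ⟨p, hA, hm.symm⟩)
      · exact c.fst_ne_snd m₁ (memA p hA) hm
  -- Away from `v`, the passages of `f` are passages of `c`. A transition that meets `f` is
  -- therefore one of these passages, with flows `-1` and `1`.
  · have key : ∀ h h' : H, P.IsTransition h h' → F.vert h ≠ v →
        ∀ p ∈ f.passages, h ∈ s(p.1, p.2) → f.flow h + f.flow h' = 0 := by
      intro h h' ht hv p hp hm
      rcases memf.1 hp with rfl | hA
      · rw [Sym2.mem_iff] at hm
        rcases hm with rfl | rfl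
        exacts [absurd hv₃ hv, absurd hv₂ hv]
      · have hpt := CircuitPartition.isTransition_of_mem hc (memA p hA)
        have := f.flow_add_flow_of_mem hp
        rw [Sym2.mem_iff] at hm
        rcases hm with rfl | rfl
        · rwa [ht.unique hpt]
        · rw [ht.unique hpt.symm]; linarith
    intro h h' ht hv
    by_cases e₁ : ∃ p ∈ f.passages, h ∈ s(p.1, p.2)
    · obtain ⟨p, hp, hm⟩ := e₁
      exact key h h' ht hv p hp hm
    by_cases e₂ : ∃ p ∈ f.passages, h' ∈ s(p.1, p.2)
    · obtain ⟨p, hp, hm⟩ := e₂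
      rw [add_comm]
      exact key h' h ht.symm (ht.vert_eq ▸ hv) p hp hm
    · push Not at e₁ e₂
      rw [f.flow_eq_zero e₁, f.flow_eq_zero e₂, add_zero]

namespace FundamentalCircuits

variable {C : EulerSystem F} (Γ : FundamentalCircuits C)

/-- The matrix whose `v` row is the flow of the fundamental circuit at `v`. -/
noncomputable def flowMatrix : Matrix V H ℤ := Matrix.of fun v => (Γ.circuit v).flow

/-- There are linear functionals dual to the flows of the fundamental circuits, each of which is
the sum of the values on the two half-edges of a transition of the Euler system. -/
theorem exists_dual [DecidableEq V] :
    ∃ t₁ t₂ : V → H, (∀ v, C.toCircuitPartition.IsTransition (t₁ v) (t₂ v)) ∧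
      (∀ v, F.vert (t₁ v) = v) ∧
      ∀ u v, Γ.flowMatrix u (t₁ v) + Γ.flowMatrix u (t₂ v) = if u = v then 1 else 0 := by
  have h : ∀ v, ∃ h₁ h₂ : H, C.toCircuitPartition.IsTransition h₁ h₂ ∧ F.vert h₁ = v ∧
      (Γ.circuit v).flow h₁ + (Γ.circuit v).flow h₂ = 1 := by
    intro v
    obtain ⟨c, hc, hf⟩ := Γ.isFundamental v
    exact (hf.exists_transition (P := C.toCircuitPartition) hc).1
  choose t₁ t₂ ht hv h1 using h
  refine ⟨t₁, t₂, ht, hv, fun u v => ?_⟩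
  by_cases huv : u = v
  · subst huv
    simpa [flowMatrix] using h1 u
  · rw [if_neg huv]
    obtain ⟨c, hc, hf⟩ := Γ.isFundamental u
    refine (hf.exists_transition (P := C.toCircuitPartition) hc).2 _ _ (ht v) ?_
    rw [hv]
    exact Ne.symm huv

variable [Fintype V] [DecidableEq V]

/-- Independence of the flows: the dual functionals read off the coefficients of a combination. -/
theorem eq_of_mul_flowMatrix_eq {W : Type*} {U U' : Matrix W V ℤ}
    (h : U * Γ.flowMatrix = U' * Γ.flowMatrix) : U = U' := by
  obtain ⟨t₁, t₂, -, -, hd⟩ := Γ.exists_dual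
  have key : ∀ (U : Matrix W V ℤ) w v, (U * Γ.flowMatrix) w (t₁ v) +
      (U * Γ.flowMatrix) w (t₂ v) = U w v := by
    intro U w v
    simp [Matrix.mul_apply, ← Finset.sum_add_distrib, ← mul_add, hd]
  ext w v
  rw [← key U, ← key U', h]

/-- The flows of the fundamental circuits based at `B` span the circulations that vanish on `B`. -/
theorem exists_eq_mul_flowMatrix [Fintype H] (hF : F.IsFourRegular) {B : Set E}
    (hB : F.IsBaseEdgeSet B) (hΓ : Γ.IsBasedAt B) {W : Type*} (M : Matrix W H ℤ)
    (hM : ∀ w, M w ∈ F.circulations B) : ∃ U : Matrix W V ℤ, M = U * Γ.flowMatrix := by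
  obtain ⟨t₁, t₂, ht, hv, hd⟩ := Γ.exists_dual
  -- The coefficients are dictated by the dual functionals; the remainder is a circulation on which
  -- all of them vanish, hence zero.
  refine ⟨Matrix.of fun w v => M w (t₁ v) + M w (t₂ v), ?_⟩
  funext w
  rw [← sub_eq_zero]
  refine C.eq_zero_of_mem_circulations hF hB (Submodule.sub_mem _ (hM w) ?_) fun v =>
    ⟨t₁ v, t₂ v, ht v, hv v, ?_⟩
  · have : (Matrix.of (fun w v => M w (t₁ v) + M w (t₂ v)) * Γ.flowMatrix) w =
        ∑ v, (M w (t₁ v) + M w (t₂ v)) • (Γ.circuit v).flow := by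
      ext h
      simp [Matrix.mul_apply, flowMatrix]
    rw [this]
    exact Submodule.sum_mem _ fun v _ => Submodule.smul_mem _ _
      ((Γ.circuit v).flow_mem_circulations (hΓ v))
  · have : ∑ u, (M w (t₁ u) + M w (t₂ u)) * (Γ.flowMatrix u (t₁ v) + Γ.flowMatrix u (t₂ v)) =
        M w (t₁ v) + M w (t₂ v) := by
      simp [hd]
    simp only [mul_add, Finset.sum_add_distrib] at this
    simp only [Pi.sub_apply, Matrix.mul_apply, Matrix.of_apply]
    linarith

/-- The flows of two families of fundamental circuits based at the same base edges are related by
an invertible integer matrix. -/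
theorem exists_flowMatrix_eq_mul [Finite H] (hF : F.IsFourRegular) {B : Set E}
    (hB : F.IsBaseEdgeSet B) (hΓ : Γ.IsBasedAt B) {C' : EulerSystem F}
    (Γ' : FundamentalCircuits C') (hΓ' : Γ'.IsBasedAt B) :
    ∃ U L : Matrix V V ℤ, U * L = 1 ∧ Γ'.flowMatrix = U * Γ.flowMatrix := by
  have := Fintype.ofFinite H
  obtain ⟨U, hU⟩ := Γ.exists_eq_mul_flowMatrix hF hB hΓ Γ'.flowMatrix
    fun v => (Γ'.circuit v).flow_mem_circulations (hΓ' v)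
  obtain ⟨L, hL⟩ := Γ'.exists_eq_mul_flowMatrix hF hB hΓ' Γ.flowMatrix
    fun v => (Γ.circuit v).flow_mem_circulations (hΓ v)
  -- Expressing each family in the other gives `U * L` times the flows of `Γ'` equal to those flows;
  -- independence cancels them.
  refine ⟨U, L, Γ'.eq_of_mul_flowMatrix_eq ?_, hU⟩
  rw [Matrix.mul_assoc, ← hL, ← hU, Matrix.one_mul]

end FundamentalCircuits

/-! ### Touch-graphs -/

theorem toMultiset_cycleFilter {α : Type*} (q : α → Prop) [DecidablePred q] (s : Cycle α) :
    (cycleFilter q s).toMultiset = s.toMultiset.filter q := by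
  induction s using Quotient.inductionOn'
  rfl

theorem toMultiset_map {α β : Type*} (f : α → β) (s : Cycle α) :
    (s.map f).toMultiset = s.toMultiset.map f := by
  induction s using Quotient.inductionOn'
  rfl

theorem sum_map_filter {α M : Type*} [AddCommMonoid M] (q : α → Prop) [DecidablePred q]
    (f : α → M) (s : Multiset α) :
    ((s.filter q).map f).sum = (s.map fun a => if q a then f a else 0).sum := by
  induction s using Multiset.induction_on with
  | empty => rfl
  | cons a s ih => by_cases h : q a <;> simp [h, ih]

open Classical in
/-- A half-edge of `F` contributes `-1` to the coordinate `v` if its shadow is the initial half-edge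
of `e_v`. -/
noncomputable def initialMatrix (hF : F.IsFourRegular) (P : CircuitPartition F)
    (D : (P.touchGraph hF).Orientation) : Matrix H V ℤ :=
  Matrix.of fun h v => if F.vert h = v ∧ P.shadowHalfEdge h = D.init v then -1 else 0

/-- With `g` the column `v` of `initialMatrix`, a passage `(h, h')` contributes `g h' - g h`: this
is `1` if the shadow step starts at the initial half-edge of `e_v`, `-1` if it ends there, and `0`
if the two shadows agree or the passage is at another vertex. -/
theorem z_shadow [Fintype H] (hF : F.IsFourRegular) (P : CircuitPartition F)
    (D : (P.touchGraph hF).Orientation) (c : OrientedCircuit F) (v : V) :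
    D.z (P.shadow c) v = ∑ h, c.flow h * initialMatrix hF P D h v := by
  classical
  have vertex_shadow : ∀ h : H, (P.touchGraph hF).edge (P.shadowHalfEdge h) = F.vert h :=
    fun h => CircuitPartition.SingleTransition.vertex_eq (P.mem_shadowHalfEdge h)
  rw [c.sum_flow_mul fun h => initialMatrix hF P D h v]
  unfold Orientation.z CircuitPartition.shadow
  rw [toMultiset_map, toMultiset_cycleFilter, Multiset.map_map, sum_map_filter]
  refine congrArg Multiset.sum (Multiset.map_congr rfl fun p hp => ?_)
  replace hp := OrientedCircuit.toMultiset_mem.1 hp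
  have hne : p.1 ≠ p.2 := c.fst_ne_snd hp hp
  have hinc := c.incident p hp
  have htr : (∃ γ ∈ P.circuits, s(p.1, p.2) ∈ γ.singleTransitions) ↔
      P.shadowHalfEdge p.1 = P.shadowHalfEdge p.2 :=
    CircuitPartition.isTransition_iff_shadowHalfEdge_eq hne
  simp only [Function.comp_apply, Prod.map_fst, vertex_shadow, initialMatrix, Matrix.of_apply,
    htr]
  by_cases hs : P.shadowHalfEdge p.1 = P.shadowHalfEdge p.2
  · simp [hs, hinc]
  by_cases hv : F.vert p.1 = v
  · have hv₂ : F.vert p.2 = v := hinc ▸ hv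
    -- Distinct shadows at `v` are the two halves of `e_v`, so one of them is initial.
    have hinit : P.shadowHalfEdge p.1 = D.init v ∨ P.shadowHalfEdge p.2 = D.init v := by
      rcases eq_or_eq_of_edge_eq (F := P.touchGraph hF) (h := D.init v) hs
        (by rw [vertex_shadow, vertex_shadow, hinc]) (by rw [D.edge_init, vertex_shadow, hv₂])
        with h | h
      exacts [Or.inl h.symm, Or.inr h.symm]
    rcases hinit with h | h
    · have h' : P.shadowHalfEdge p.2 ≠ D.init v := fun h' => hs (h.trans h'.symm)
      simp [hv, hv₂, h, h', h'.symm]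
    · have h' : P.shadowHalfEdge p.1 ≠ D.init v := fun h' => hs (h'.trans h.symm)
      simp [hv, hv₂, h, h']
  · have hv₂ : F.vert p.2 ≠ v := hinc ▸ hv
    simp [hv, hv₂]

theorem signedMatrix_eq_mul [Fintype H] (hF : F.IsFourRegular) {C : EulerSystem F}
    (Γ : FundamentalCircuits C) (P : CircuitPartition F) (D : (P.touchGraph hF).Orientation) :
    signedMatrix hF C Γ P D = Γ.flowMatrix * initialMatrix hF P D := by
  ext u v
  exact z_shadow hF P D (Γ.circuit u) v

end HalfEdgeGraph

/-! ### The main theorem -/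

theorem mainTheorem4 {V E H : Type*} [Fintype V] [DecidableEq V]
    (F : HalfEdgeGraph V E H) (hF : F.IsFourRegular)
    (B : Set E) (hB : F.IsBaseEdgeSet B)
    (C C' : HalfEdgeGraph.EulerSystem F)
    (Γ : HalfEdgeGraph.FundamentalCircuits C) (hΓ : Γ.IsBasedAt B)
    (Γ' : HalfEdgeGraph.FundamentalCircuits C') (hΓ' : Γ'.IsBasedAt B) :
    (∀ (P : HalfEdgeGraph.CircuitPartition F) (D : (P.touchGraph hF).Orientation),
      RowEquivalent (HalfEdgeGraph.signedMatrix hF C Γ P D)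
        (HalfEdgeGraph.signedMatrix hF C' Γ' P D)) ∧
    ∃ ops : List (RowOp V),
      ∀ (P : HalfEdgeGraph.CircuitPartition F) (D : (P.touchGraph hF).Orientation),
        RowOp.applyAll ops (HalfEdgeGraph.signedMatrix hF C Γ P D) =
          HalfEdgeGraph.signedMatrix hF C' Γ' P D := by
  have := hF.finite_halfEdges
  have := Fintype.ofFinite H
  obtain ⟨U, L, hUL, hU⟩ := Γ.exists_flowMatrix_eq_mul hF hB hΓ Γ' hΓ'
  obtain ⟨ops, hops⟩ := Matrix.exists_applyAll_eq_mul hUL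
  have key : ∀ (P : HalfEdgeGraph.CircuitPartition F) (D : (P.touchGraph hF).Orientation),
      RowOp.applyAll ops (HalfEdgeGraph.signedMatrix hF C Γ P D) =
        HalfEdgeGraph.signedMatrix hF C' Γ' P D := by
    intro P D
    rw [hops, HalfEdgeGraph.signedMatrix_eq_mul, HalfEdgeGraph.signedMatrix_eq_mul, hU,
      Matrix.mul_assoc]
  exact ⟨fun P D => ⟨ops, key P D⟩, ops, key⟩
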